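/- Let $p$ be an odd prime. Let $\mathcal Q(p)$ be the universal Steenrod algebra, i.e. the unital associative $\mathbb F_p$-algebra generated by the symbols $z_{\epsilon,k}$ with $(\epsilon,k)\in\{0,1\}\times\mathbb Z$, subject to the generalized Adem relations $R(\epsilon,k,n)=0$ and $S(\epsilon,k,n)=0$ for all $\epsilon\in\{0,1\}$, $k\in\mathbb Z$ and integers $n\ge 0$, where $$R(\epsilon,k,n)=z_{\epsilon,pk-1-n}z_{0,k}+\sum_{j\ge 0}(-1)^j\binom{(p-1)(n-j)-1}{j}z_{\epsilon,pk-1-j}z_{0,k-n+j},$$ $$S(\epsilon,k,n)=z_{\epsilon,pk-n}z_{1,k}+\sum_{j\ge 0}(-1)^{j}\binom{(p-1)(n-j)-1}{j}z_{\epsilon,pk-j}z_{1,k-n+j}+(1-\epsilon)\sum_{j\ge 0}(-1)^{j+1}\binom{(p-1)(n-j)}{j}z_{1,pk-j}z_{0,k-n+j},$$ and $\binom{a}{j}$ is understood to be $0$ if $a<0$ or $0\le a<j$ (so all sums are finite). A monic monomial $z_{\epsilon_1,i_1}z_{\epsilon_2,i_2}\cdots z_{\epsilon_m,i_m}$ ($m\ge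 0$, the empty monomial being $1$) is called admissible if $i_j\ge p\,i_{j+1}+\epsilon_{j+1}$ for $1\le j\le m-1$. For an integer $s\ge 0$ let $\mathcal Q^1_s$ be the subalgebra of $\mathcal Q(p)$ generated by $1$ and the elements $z_{1,p^s m}$, $m\in\mathbb Z$. Then the admissible monic monomials in the generators $z_{1,p^s m}$ (with distinct labels giving distinct elements) form an $\mathbb F_p$-linear basis of $\mathcal Q^1_s$. Moreover, a monomial $z_{1,p^sh_1}z_{1,p^sh_2}\cdots z_{1,p^sh_m}$ with $h_1,\dots,h_m\in\mathbb Z$ is admissible if and only if $h_i\ge p\,h_{i+1}+1$ for all $1\le i\le m-1$. -/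

import Mathlib

open scoped BigOperators

noncomputable section

namespace UnivSteenrod

/-- Indices `(ε, k) ∈ {0,1} × ℤ` of the generators `z_{ε,k}`. -/
abbrev Idx : Type := Fin 2 × ℤ

/-- The free associative unital `𝔽_p`-algebra on the symbols `z_{ε,k}`. -/
abbrev FreeZ (p : ℕ) : Type := FreeAlgebra (ZMod p) Idx

/-- The symbol `z_{ε,k}` in the free algebra. -/
def gen (p : ℕ) (ε : Fin 2) (k : ℤ) : FreeZ p := FreeAlgebra.ι (ZMod p) (ε, k)

/-- The binomial coefficient `a choose j` with the convention of the Adem relations: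
it vanishes when `a < 0` (and when `0 ≤ a < j`). -/
def binom (a : ℤ) (j : ℕ) : ℕ := if 0 ≤ a then a.toNat.choose j else 0

/-- The generalized Adem relation `R(ε,k,n)`. All terms with `j > n` vanish, as the upper entry of
the binomial coefficient is then negative, so the sum runs over `0 ≤ j ≤ n`. -/
def relR (p : ℕ) (ε : Fin 2) (k : ℤ) (n : ℕ) : FreeZ p :=
  gen p ε (p * k - 1 - n) * gen p 0 k
    + ∑ j ∈ Finset.range (n + 1),
        ((-1 : ZMod p) ^ j * (binom (((p : ℤ) - 1) * ((n : ℤ) - j) - 1) j : ZMod p)) •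
          (gen p ε (p * k - 1 - j) * gen p 0 (k - n + j))

/-- The generalized Adem relation `S(ε,k,n)`. Again all terms with `j > n` vanish.
The signs are those for which `z_{ε,k} ↦ β^ε P^k` (and `z_{ε,k} ↦ 0` for `k < 0`) respects the
Adem relations of the Steenrod algebra at the odd prime `p`. -/
def relS (p : ℕ) (ε : Fin 2) (k : ℤ) (n : ℕ) : FreeZ p :=
  gen p ε (p * k - n) * gen p 1 k
    + ∑ j ∈ Finset.range (n + 1),
        ((-1 : ZMod p) ^ j * (binom (((p : ℤ) - 1) * ((n : ℤ) - j) - 1) j : ZMod p)) •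
          (gen p ε (p * k - j) * gen p 1 (k - n + j))
    + (1 - ((ε : ℕ) : ZMod p)) • ∑ j ∈ Finset.range (n + 1),
        ((-1 : ZMod p) ^ (j + 1) * (binom (((p : ℤ) - 1) * ((n : ℤ) - j)) j : ZMod p)) •
          (gen p 1 (p * k - j) * gen p 0 (k - n + j))

/-- The defining relations: every `R(ε,k,n)` and every `S(ε,k,n)` is set equal to `0`. -/
inductive Rel (p : ℕ) : FreeZ p → FreeZ p → Prop
  | R (ε : Fin 2) (k : ℤ) (n : ℕ) : Rel p (relR p ε k n) 0
  | S (ε : Fin 2) (k : ℤ) (n : ℕ) : Rel p (relS p ε k n) 0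

/-- The universal Steenrod algebra `Q(p)`: the free algebra modulo the two-sided ideal generated by
the generalized Adem relations. -/
abbrev Q (p : ℕ) : Type := RingQuot (Rel p)

/-- The generator `z_{ε,k}` of `Q(p)`. -/
def z (p : ℕ) (x : Idx) : Q p := RingQuot.mkAlgHom (ZMod p) (Rel p) (gen p x.1 x.2)

/-- The monic monomial `z_I = z_{ε₁,i₁} ⋯ z_{ε_m,i_m}` with label `I`; `z_∅ = 1`. -/
def zMon (p : ℕ) (I : List Idx) : Q p := (I.map (z p)).prod

/-- A label is admissible if `i_j ≥ p i_{j+1} + ε_{j+1}` for all consecutive entries. -/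
def Admissible (p : ℕ) (I : List Idx) : Prop :=
  I.IsChain fun x y => (p : ℤ) * y.2 + ((y.1 : ℕ) : ℤ) ≤ x.2

/-- The subalgebra `Q^1_s` of `Q(p)` generated by `1` and the `z_{1,p^s m}`, `m ∈ ℤ`. -/
def Q1 (p s : ℕ) : Subalgebra (ZMod p) (Q p) :=
  Algebra.adjoin (ZMod p) (Set.range fun m : ℤ => z p (1, (p : ℤ) ^ s * m))

/-- The label `(1, p^s h₁; …; 1, p^s h_m)`. -/
def label1 (p s : ℕ) (h : List ℤ) : List Idx := h.map fun m => (1, (p : ℤ) ^ s * m)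

/-- The labels of the admissible monomials in the generators `z_{1,p^s m}` of `Q^1_s`. -/
def admLabels1 (p s : ℕ) : Set (List Idx) :=
  {I | I ∈ Set.range (label1 p s) ∧ Admissible p I}

end UnivSteenrod

end

/-!
Both halves rest on the relations `S(1,k,n)`, which involve no generator `z_{0,*}` once `ε = 1`.

*Spanning.* By Lucas' theorem, `S(1, p ^ s k, p ^ s n)` only involves indices divisible by `p ^ s`,
so it rewrites a nonadmissible product of two generators of `Q^1_s` in terms of such products
(`zMon_pair_mem_span`). A rewriting step moves weight from an index to its left neighbour, so the sum
of the `(m - i) (K - h_i)` decreases; it stays nonnegative because the `p ^ i h_i` remain bounded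
(`zMon_mem_span`).

*Independence.* Setting all `z_{0,*}` to `0` leaves an algebra with the relations `S(1,k,n)`, and
linear functionals on its part of length `m` are the functions on words in `ℤ ^ m` that are
annihilated by these relations at every pair of adjacent letters; `Sym` collects them, and `Q(p)`
acts on `Sym` from the right by deleting first letters (`act`). The coefficient of
`z_{1,pk-n+i} z_{1,k-i}` in `S(1,k,n)` is that of `X ^ n` in `y ^ i / (1 - X)` with
`y = X (1 - X) ^ (p - 1)`, and the identity `(1 - X) y = X (1 - X ^ p)` says that the relations on two
letters are stable under the translation operators `e = u ^ p v` and `c = u ^ (p - 1) v + u ^ p`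
(`dicksonC_mem`). The Dickson invariants in `m` variables are polynomials in `e`, `c` at any two
adjacent places, so they act on `Sym` (`dickson_mem`). Each lowers the leading word of a function in
a controlled way (`Leads.dickson`). Applied to the indicator functions of words with all gaps
`a - p b` equal to `1`, which lie in `Sym`, they produce for each admissible word a function in `Sym`
with this leading word (`exists_leads`), and independence follows by triangularity.
-/

open scoped BigOperators

noncomputable section

namespace UnivSteenrod

/-! ### The coefficients of the relations among the `z_{1,k}` -/

section Coefficients

open PowerSeries

/-- The coefficient of `z_{1,pk-n+i} z_{1,k-i}` in `S(1,k,n)`, packaged as the coefficient of `X ^ n`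
in `y ^ i / (1 - X)`, where `y = X (1 - X) ^ (p - 1)`. -/
def ademCoeff (p n i : ℕ) : ZMod p :=
  coeff n ((mk 1 : PowerSeries (ZMod p)) * (X * (1 - X) ^ (p - 1)) ^ i)

variable {p : ℕ}

theorem ademCoeff_zero (n : ℕ) : ademCoeff p n 0 = 1 := by
  simp [ademCoeff]

theorem coeff_one_sub_X_pow (N j : ℕ) :
    coeff j ((1 - X : PowerSeries (ZMod p)) ^ N) = (-1) ^ j * (N.choose j : ZMod p) := by
  have h : (1 - X : PowerSeries (ZMod p)) ^ N =
      rescale (-1) (((1 + Polynomial.X) ^ N : Polynomial (ZMod p)) : PowerSeries (ZMod p)) := by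
    simp [rescale_X, sub_eq_add_neg]
  rw [h, coeff_rescale, Polynomial.coeff_coe, Polynomial.coeff_one_add_X_pow]

theorem mk_one_mul_pow_eq (hp : 2 ≤ p) (i : ℕ) :
    (mk 1 : PowerSeries (ZMod p)) * (X * (1 - X) ^ (p - 1)) ^ (i + 1) =
      X ^ (i + 1) * (1 - X) ^ ((p - 1) * (i + 1) - 1) := by
  have h1 : (p - 1) * (i + 1) = ((p - 1) * (i + 1) - 1) + 1 := by
    have : 0 < (p - 1) * (i + 1) := Nat.mul_pos (by omega) (by omega)
    omega
  rw [mul_pow, ← pow_mul]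
  conv_lhs => rw [h1, pow_succ]
  linear_combination (X ^ (i + 1) * (1 - X) ^ ((p - 1) * (i + 1) - 1)) *
    mk_one_mul_one_sub_eq_one (ZMod p)

theorem ademCoeff_succ (hp : 2 ≤ p) (n i : ℕ) :
    ademCoeff p n (i + 1) = if i + 1 ≤ n then
      (-1) ^ (n - (i + 1)) * (((p - 1) * (i + 1) - 1).choose (n - (i + 1)) : ZMod p) else 0 := by
  rw [ademCoeff, mk_one_mul_pow_eq hp, coeff_X_pow_mul']
  split_ifs
  · exact coeff_one_sub_X_pow _ _
  · rfl

theorem ademCoeff_eq_zero_of_lt {n i : ℕ} (h : n < i) : ademCoeff p n i = 0 := by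
  rw [ademCoeff, mul_pow, mul_left_comm, coeff_X_pow_mul', if_neg (by omega)]

/-- The coefficient form of `(1 - X) y = X (1 - X ^ p)`. It says that multiplication by the second
invariant `c` carries relations to combinations of relations. -/
theorem ademCoeff_add [Fact p.Prime] (n i : ℕ) :
    ademCoeff p n (i + 1) + ademCoeff p n i =
      ademCoeff p (n + 1) (i + 1) + if p ≤ n then ademCoeff p (n - p) i else 0 := by
  have hp : p - 1 + 1 = p := Nat.sub_add_cancel (Fact.out : p.Prime).one_le
  set y : PowerSeries (ZMod p) := X * (1 - X) ^ (p - 1) with hy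
  have hfrob : (1 - X) * y = X * (1 - X ^ p) := by
    have : CharP (PowerSeries (ZMod p)) p :=
      charP_of_injective_algebraMap
        (algebraMap (ZMod p) (PowerSeries (ZMod p))).injective p
    have h : (1 - X : PowerSeries (ZMod p)) ^ p = 1 - X ^ p := by
      rw [sub_pow_char, one_pow]
    have h' : (1 - X : PowerSeries (ZMod p)) ^ (p - 1) * (1 - X) = 1 - X ^ p := by
      rw [← pow_succ, hp, h]
    rw [hy]
    linear_combination X * h'
  have key : X * ((mk 1 : PowerSeries (ZMod p)) * y ^ (i + 1)) + X * (mk 1 * y ^ i) =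
      mk 1 * y ^ (i + 1) + X ^ (p + 1) * (mk 1 * y ^ i) := by
    linear_combination (-(mk 1 : PowerSeries (ZMod p)) * y ^ i) * hfrob
  have h := congrArg (coeff (n + 1)) key
  simp only [map_add, coeff_succ_X_mul, coeff_X_pow_mul'] at h
  simpa [ademCoeff, ← hy] using h

end Coefficients

/-! ### Coefficient arrays in two variables -/

section TwoVariables

variable (p : ℕ)

/-- Arrays `G : ℤ × ℤ → 𝔽_p` annihilated by all relations `S(1,k,n)` (with `z_{0,*}` set to `0`). -/
def Sym₂ : Submodule (ZMod p) (ℤ → ℤ → ZMod p) where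
  carrier := {G | ∀ (k : ℤ) (n : ℕ),
    ∑ i ∈ Finset.range (n + 1), ademCoeff p n i * G (p * k - n + i) (k - i) = 0}
  add_mem' {G H} hG hH k n := by
    simp [mul_add, Finset.sum_add_distrib, hG k n, hH k n]
  zero_mem' k n := by simp
  smul_mem' c G hG k n := by
    have := congrArg (c * ·) (hG k n)
    simpa [Finset.mul_sum, mul_left_comm] using this

/-- Translation of arrays by `(a, b)`: the action of the Laurent monomial `u ^ a v ^ b`. -/
def translate (a b : ℤ) : Module.End (ZMod p) (ℤ → ℤ → ZMod p) where
  toFun G x y := G (x + a) (y + b)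
  map_add' _ _ := rfl
  map_smul' _ _ := rfl

/-- The action of the invariant `c = u ^ (p - 1) v + u ^ p`. -/
def dicksonC : Module.End (ZMod p) (ℤ → ℤ → ZMod p) :=
  translate p (p - 1) 1 + translate p p 0

variable {p}

theorem translate_mul (a b c d : ℤ) :
    translate p a b * translate p c d = translate p (a + c) (b + d) := by
  ext G x y
  simp [translate, Module.End.mul_apply, add_assoc]

theorem translate_pow (a b : ℤ) (n : ℕ) : translate p a b ^ n = translate p (n * a) (n * b) := by
  induction n with
  | zero => ext G x y; simp [translate]
  | succ n ih =>
    rw [pow_succ, ih, translate_mul]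
    push_cast
    ring_nf

/-- The invariant `e = u ^ p v` and its inverse preserve the relations, by translating `k`. -/
theorem translate_mem {G : ℤ → ℤ → ZMod p} (hG : G ∈ Sym₂ p) (B : ℤ) :
    translate p (p * B) B G ∈ Sym₂ p := by
  intro k n
  rw [← hG (k + B) n]
  refine Finset.sum_congr rfl fun i _ => ?_
  change _ * G _ _ = _
  ring_nf

/-- The invariant `c` carries the relation `(k, n)` to the sum of the relations `(k + 1, n + 1)` and,
if `p ≤ n`, `(k, n - p)`. -/
theorem dicksonC_mem [Fact p.Prime] {G : ℤ → ℤ → ZMod p} (hG : G ∈ Sym₂ p) :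
    dicksonC p G ∈ Sym₂ p := by
  intro k n
  set H : ℕ → ZMod p := fun i => G (p * (k + 1) - (n + 1 : ℕ) + i) (k + 1 - i) with hH
  have h1 : ∀ i ∈ Finset.range (n + 1), ademCoeff p n i *
      dicksonC p G (p * k - n + i) (k - i) =
        ademCoeff p n i * H i + ademCoeff p n i * H (i + 1) := by
    intro i _
    have e1 : (p : ℤ) * k - n + i + (p - 1) = p * (k + 1) - (n + 1 : ℕ) + i := by
      push_cast; ring
    have e2 : k - (i : ℤ) + 1 = k + 1 - i := by ring
    have e3 : (p : ℤ) * k - n + i + p = p * (k + 1) - (n + 1 : ℕ) + (i + 1 : ℕ) := by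
      push_cast; ring
    have e4 : k - (i : ℤ) + 0 = k + 1 - (i + 1 : ℕ) := by push_cast; ring
    rw [← mul_add]
    congr 1
    change G _ _ + G _ _ = _
    rw [e1, e2, e3, e4]
  have h2 : ∑ i ∈ Finset.range (n + 1), ademCoeff p n i * H i =
      H 0 + ∑ i ∈ Finset.range (n + 1), ademCoeff p n (i + 1) * H (i + 1) := by
    rw [Finset.sum_range_succ', Finset.sum_range_succ (fun i => ademCoeff p n (i + 1) * H (i + 1)),
      ademCoeff_eq_zero_of_lt (Nat.lt_succ_self n), ademCoeff_zero]
    ring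
  have h3 := hG (k + 1) (n + 1)
  rw [Finset.sum_range_succ', ademCoeff_zero, one_mul] at h3
  have h4 : ∑ i ∈ Finset.range (n + 1), (if p ≤ n then ademCoeff p (n - p) i else 0) * H (i + 1)
      = 0 := by
    split_ifs with hpn
    · rw [← hG k (n - p)]
      symm
      refine Finset.sum_subset_zero_on_sdiff (Finset.range_subset_range.2 (by omega)) ?_ ?_
      · intro i hi
        simp only [Finset.mem_sdiff, Finset.mem_range] at hi
        rw [ademCoeff_eq_zero_of_lt (by omega), zero_mul]
      · intro i _
        rw [hH]
        push_cast [hpn]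
        ring_nf
    · simp
  rw [Finset.sum_congr rfl h1, Finset.sum_add_distrib, h2, add_assoc, ← Finset.sum_add_distrib]
  have h5 : ∀ i ∈ Finset.range (n + 1),
      ademCoeff p n (i + 1) * H (i + 1) + ademCoeff p n i * H (i + 1) =
        ademCoeff p (n + 1) (i + 1) * H (i + 1) +
          (if p ≤ n then ademCoeff p (n - p) i else 0) * H (i + 1) := by
    intro i _
    rw [← add_mul, ademCoeff_add, add_mul]
  rw [Finset.sum_congr rfl h5, Finset.sum_add_distrib, h4, add_zero, add_comm]
  exact h3

/-- Powers of `c` with exponent `p ^ r` are again binomials, by the Frobenius. -/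
theorem dicksonC_pow [Fact p.Prime] (r : ℕ) :
    dicksonC p ^ p ^ r = translate p (p ^ (r + 1) - p ^ r) (p ^ r) + translate p (p ^ (r + 1)) 0 := by
  have : CharP (Module.End (ZMod p) (ℤ → ℤ → ZMod p)) p :=
    charP_of_injective_algebraMap
      (algebraMap (ZMod p) (Module.End (ZMod p) (ℤ → ℤ → ZMod p))).injective p
  have hc : Commute (translate p (p - 1) 1) (translate p p 0) := by
    rw [Commute, SemiconjBy, translate_mul, translate_mul, add_comm, add_comm (1 : ℤ)]
  rw [dicksonC, add_pow_char_pow_of_commute _ _ hc, translate_pow, translate_pow]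
  push_cast
  ring_nf

theorem dicksonC_pow_mem [Fact p.Prime] {G : ℤ → ℤ → ZMod p} (hG : G ∈ Sym₂ p) (r : ℕ) :
    (dicksonC p ^ r) G ∈ Sym₂ p := by
  induction r with
  | zero => exact hG
  | succ r ih => rw [pow_succ']; exact dicksonC_mem ih

/-- Linear functionals applied to the entries preserve the relations. -/
theorem map_mem_Sym₂ {V : Type*} [AddCommGroup V] [Module (ZMod p) V] (φ : V →ₗ[ZMod p] ZMod p)
    {H : ℤ → ℤ → V} (hH : ∀ (k : ℤ) (n : ℕ),
      ∑ i ∈ Finset.range (n + 1), ademCoeff p n i • H (p * k - n + i) (k - i) = 0) :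
    (fun x y => φ (H x y)) ∈ Sym₂ p := by
  intro k n
  have := congrArg φ (hH k n)
  simpa using this

/-- The array supported at one point `(a, b)` with `a = p b + 1` is annihilated by the relations,
as the nonadmissible word is not of this form and its coefficient in the other words vanishes. -/
theorem single_mem_Sym₂ (hp : 2 ≤ p) {G : ℤ → ℤ → ZMod p}
    (hG : ∀ x y, G x y ≠ 0 → x = p * y + 1) : G ∈ Sym₂ p := by
  intro k n
  refine Finset.sum_eq_zero fun i _ => ?_
  by_contra h
  obtain ⟨h1, h2⟩ := And.intro (left_ne_zero_of_mul h) (right_ne_zero_of_mul h)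
  have h3 := hG _ _ h2
  have h4 : (n : ℤ) + 1 = (p + 1) * i := by linear_combination -h3
  have h5 : n + 1 = (p + 1) * i := by exact_mod_cast h4
  rcases i with _ | i
  · omega
  · refine h1 ?_
    rw [ademCoeff_succ hp]
    split_ifs with hi
    · rw [Nat.choose_eq_zero_of_lt, Nat.cast_zero, mul_zero]
      have h6 : n - (i + 1) = p * (i + 1) - 1 := by
        have : (p + 1) * (i + 1) = p * (i + 1) + (i + 1) := by ring
        omega
      have h7 : p * (i + 1) = (p - 1) * (i + 1) + (i + 1) := by
        conv_lhs => rw [show p = (p - 1) + 1 by omega]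
        ring
      have : 0 < (p - 1) * (i + 1) := Nat.mul_pos (by omega) (by omega)
      omega
    · rfl

end TwoVariables

/-! ### Coefficient arrays on words and the Dickson operators -/

section Words

variable (p : ℕ)

/-- The functions `F : List ℤ → 𝔽_p` annihilated by all relations `S(1,k,n)` (with `z_{0,*}` set to
`0`) inserted at any place in a word; a word `k₁, …, k_m` stands for `z_{1,k₁} ⋯ z_{1,k_m}`. -/
def Sym : Submodule (ZMod p) (List ℤ → ZMod p) where
  carrier := {F | ∀ pre post : List ℤ, (fun x y => F (pre ++ x :: y :: post)) ∈ Sym₂ p}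
  add_mem' hF hG pre post := (Sym₂ p).add_mem (hF pre post) (hG pre post)
  zero_mem' _ _ := (Sym₂ p).zero_mem
  smul_mem' c _ hF pre post := (Sym₂ p).smul_mem c (hF pre post)

/-- Restriction of a function to the words with first letter `a`, as a function of the rest. -/
def consL (a : ℤ) : (List ℤ → ZMod p) →ₗ[ZMod p] (List ℤ → ZMod p) :=
  LinearMap.funLeft (ZMod p) (ZMod p) (List.cons a)

/-- `dickson p j l F` is the value at `l` of the `j`-th Dickson operator on `F`. On words of length
`m` this is the action, by translations, of the Dickson invariant `Q_{m,j}`, the coefficient of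
`Φ ^ j` in the product `(Φ + w_m) ⋯ (Φ + w₁)` of twisted polynomials (`Φ a = a ^ p Φ`), where
`w₁ = u₁`, `w_{i+1} = w_i ^ p u_i⁻¹ u_{i+1}`, and `u_i` translates the `i`-th letter by `1`. The
recursion splits off the factor `Φ + u₁` of the first letter. -/
def dickson : ℕ → List ℤ → (List ℤ → ZMod p) →ₗ[ZMod p] ZMod p
  | 0, [] => LinearMap.proj []
  | _ + 1, [] => 0
  | 0, a :: l => dickson 0 l ∘ₗ consL p (a + p ^ l.length)
  | j + 1, a :: l => dickson (j + 1) l ∘ₗ consL p (a + p ^ l.length) +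
      dickson j l ∘ₗ consL p (a + p ^ l.length - p ^ j)

variable {p}

@[simp] theorem consL_apply (a : ℤ) (F : List ℤ → ZMod p) (l : List ℤ) :
    consL p a F l = F (a :: l) := rfl

theorem consL_mem {F : List ℤ → ZMod p} (hF : F ∈ Sym p) (a : ℤ) : consL p a F ∈ Sym p :=
  fun pre post => hF (a :: pre) post

theorem dickson_zero_cons (a : ℤ) (l : List ℤ) (F : List ℤ → ZMod p) :
    dickson p 0 (a :: l) F = dickson p 0 l (consL p (a + p ^ l.length) F) := rfl

theorem dickson_succ_cons (j : ℕ) (a : ℤ) (l : List ℤ) (F : List ℤ → ZMod p) :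
    dickson p (j + 1) (a :: l) F = dickson p (j + 1) l (consL p (a + p ^ l.length) F) +
      dickson p j l (consL p (a + p ^ l.length - p ^ j) F) := rfl

/-- An operator on the first two letters that preserves the relations may be followed by any
functional of the remaining letters. -/
theorem dickson_comp_mem {F : List ℤ → ZMod p} (hF : F ∈ Sym p)
    (T : Module.End (ZMod p) (ℤ → ℤ → ZMod p)) (hT : ∀ G ∈ Sym₂ p, T G ∈ Sym₂ p)
    (φ : (List ℤ → ZMod p) →ₗ[ZMod p] ZMod p) :
    (fun x y => φ (fun t => T (fun x' y' => F (x' :: y' :: t)) x y)) ∈ Sym₂ p := by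
  refine map_mem_Sym₂ φ fun k n => ?_
  ext t
  simpa using hT _ (hF [] t) k n

/-- The Dickson operators preserve the relations: on two adjacent letters they only involve the
invariants `e = u ^ p v` and `c = u ^ (p - 1) v + u ^ p`. -/
theorem dickson_mem [Fact p.Prime] (j : ℕ) {F : List ℤ → ZMod p} (hF : F ∈ Sym p) :
    (fun l => dickson p j l F) ∈ Sym p := by
  intro pre
  induction pre generalizing F j with
  | nil =>
    intro post
    have hE (φ : (List ℤ → ZMod p) →ₗ[ZMod p] ZMod p) (B : ℤ) :
        (fun x y => φ (consL p (y + B) (consL p (x + p * B) F))) ∈ Sym₂ p :=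
      dickson_comp_mem hF (translate p (p * B) B) (fun _ hG => translate_mem hG B) φ
    have hC (φ : (List ℤ → ZMod p) →ₗ[ZMod p] ZMod p) (B : ℤ) (r : ℕ) :
        (fun x y => φ (consL p (y + B - p ^ r) (consL p (x + p * B) F)) +
          φ (consL p (y + B) (consL p (x + p * B - p ^ r) F))) ∈ Sym₂ p := by
      have h := dickson_comp_mem hF
        (dicksonC p ^ p ^ r * translate p (p * (B - p ^ r)) (B - p ^ r))
        (fun _ hG => dicksonC_pow_mem (translate_mem hG _) _) φ
      rw [dicksonC_pow, add_mul, translate_mul, translate_mul] at h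
      convert h using 3 with x y
      rw [← map_add]
      congr 1
      ext t
      simp only [Pi.add_apply, consL_apply, LinearMap.add_apply, translate, LinearMap.coe_mk,
        AddHom.coe_mk]
      rw [add_comm]
      congr 4
      all_goals ring_nf
    simp only [List.nil_append]
    rcases j with _ | j
    · convert hE (dickson p 0 post) (p ^ post.length) using 3 with x y
      rw [dickson_zero_cons, dickson_zero_cons, List.length_cons, pow_succ']
    · have h1 := hE (dickson p (j + 1) post) (p ^ post.length)
      have h2 := hC (dickson p j post) (p ^ post.length) j
      rcases j with _ | j
      · convert (Sym₂ p).add_mem h1 h2 using 3 with x y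
        simp only [Pi.add_apply]
        rw [dickson_succ_cons, dickson_succ_cons, dickson_zero_cons, List.length_cons, pow_succ']
        ring
      · have h3 := hE (dickson p j post) (p ^ post.length - p ^ j)
        convert (Sym₂ p).add_mem ((Sym₂ p).add_mem h1 h2) h3 using 3 with x y
        simp only [Pi.add_apply]
        rw [dickson_succ_cons, dickson_succ_cons, dickson_succ_cons, List.length_cons, pow_succ',
          add_sub_assoc y, mul_sub, ← pow_succ', ← pow_succ', ← add_sub_assoc x]
        ring_nf
  | cons a pre ih =>
    intro post
    have hlen (x y : ℤ) : (pre ++ x :: y :: post).length = pre.length + (post.length + 2) := by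
      simp
    rcases j with _ | j
    · simp only [List.cons_append, dickson_zero_cons, hlen]
      exact ih 0 (consL_mem hF _) post
    · simp only [List.cons_append, dickson_succ_cons, hlen]
      exact (Sym₂ p).add_mem (ih (j + 1) (consL_mem hF _) post) (ih j (consL_mem hF _) post)

/-! ### Leading words -/

variable (p) in
/-- Translation of a word by the exponents of the leading monomial `w_{j+1} ⋯ w_m` of `Q_{m,j}`. -/
def raise : ℕ → List ℤ → List ℤ
  | _, [] => []
  | 0, a :: l => (a + p ^ l.length) :: raise 0 l
  | j + 1, a :: l => (a + p ^ l.length - p ^ j) :: raise j l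

@[simp] theorem length_raise (j : ℕ) (l : List ℤ) : (raise p j l).length = l.length := by
  induction l generalizing j with
  | nil => simp [raise]
  | cons a l ih => cases j <;> simp [raise, ih]

theorem cons_le_cons_iff_lex {α : Type*} [LinearOrder α] {a b : α} {l t : List α} :
    a :: l ≤ b :: t ↔ a < b ∨ (a = b ∧ l ≤ t) := by
  rw [← not_lt, ← not_lt, List.cons_lt_cons_iff]
  constructor
  · intro h
    push Not at h
    grind
  · rintro (h | ⟨h1, h2⟩) <;> grind

/-- `F` takes the value `1` at `w`, and is otherwise supported on lexicographically smaller words of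
the same length. -/
def Leads (F : List ℤ → ZMod p) (w : List ℤ) : Prop :=
  F w = 1 ∧ ∀ l, F l ≠ 0 → l.length = w.length ∧ l ≤ w

/-- The Dickson operators combine values of `F` at words of the same length only. -/
theorem dickson_ne_zero {j : ℕ} {l : List ℤ} {F : List ℤ → ZMod p} (h : dickson p j l F ≠ 0) :
    ∃ t, t.length = l.length ∧ F t ≠ 0 := by
  induction l generalizing j F with
  | nil =>
    rcases j with _ | j
    · exact ⟨[], rfl, h⟩
    · exact absurd rfl h
  | cons a l ih =>
    have aux {j : ℕ} {b : ℤ} (h : dickson p j l (consL p b F) ≠ 0) :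
        ∃ t, t.length = (a :: l).length ∧ F t ≠ 0 := by
      obtain ⟨t, ht, hF⟩ := ih h
      exact ⟨b :: t, by simp [ht], hF⟩
    rcases j with _ | j
    · exact aux h
    · rw [dickson_succ_cons] at h
      by_cases h1 : dickson p (j + 1) l (consL p (a + p ^ l.length) F) = 0
      · rw [h1, zero_add] at h
        exact aux h
      · exact aux h1

theorem Leads.consL {F : List ℤ → ZMod p} {a : ℤ} {w : List ℤ} (h : Leads F (a :: w)) :
    Leads (consL p a F) w :=
  ⟨h.1, fun l hl => by
    have := h.2 (a :: l) hl
    simpa [cons_le_cons_iff_lex] using this⟩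

theorem Leads.head_le {F : List ℤ → ZMod p} {a b : ℤ} {w t : List ℤ} (h : Leads F (a :: w))
    (ht : F (b :: t) ≠ 0) : b ≤ a := by
  have := (h.2 _ ht).2
  rw [cons_le_cons_iff_lex] at this
  omega

/-- The `j`-th Dickson operator has leading monomial `w_{j+1} ⋯ w_m`. -/
theorem Leads.dickson [Fact p.Prime] {F : List ℤ → ZMod p} {j : ℕ} {w : List ℤ}
    (hj : j ≤ w.length) (h : Leads F (raise p j w)) : Leads (fun l => dickson p j l F) w := by
  induction w generalizing F j with
  | nil =>
    obtain rfl : j = 0 := by simpa using hj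
    refine ⟨h.1, fun l hl => ?_⟩
    obtain ⟨t, ht, hF⟩ := dickson_ne_zero hl
    have := h.2 t hF
    have h0 : l.length = 0 := by rw [← ht, this.1]; rfl
    rw [List.length_eq_zero_iff] at h0
    subst h0
    exact ⟨rfl, le_rfl⟩
  | cons a w ih =>
    -- words with the same first letter are handled by induction, the others have a smaller one
    suffices key : UnivSteenrod.dickson p j (a :: w) F = 1 ∧ ∀ b l, l.length = w.length →
        UnivSteenrod.dickson p j (b :: l) F ≠ 0 → b < a ∨ (b = a ∧ l ≤ w) by
      refine ⟨key.1, fun l hl => ?_⟩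
      obtain ⟨t, ht, hF⟩ := dickson_ne_zero hl
      have hlen := (h.2 t hF).1
      rw [length_raise, ht] at hlen
      refine ⟨hlen, ?_⟩
      rcases l with _ | ⟨b, l⟩
      · simp at hlen
      · rw [cons_le_cons_iff_lex]
        exact key.2 b l (by simpa using hlen) hl
    rcases j with _ | j
    · have h1 := ih (Nat.zero_le _) h.consL
      refine ⟨h1.1, fun b l hl hb => ?_⟩
      rw [dickson_zero_cons, hl] at hb
      obtain ⟨t, ht, hF⟩ := dickson_ne_zero hb
      have hle := h.head_le hF
      rcases (show b ≤ a by linarith).lt_or_eq with hlt | rfl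
      · exact Or.inl hlt
      · exact Or.inr ⟨rfl, (h1.2 l hb).2⟩
    · have hpos : (0 : ℤ) < p ^ j :=
        pow_pos (by exact_mod_cast (Fact.out : p.Prime).pos) j
      have hsmall (b : ℤ) (l : List ℤ) (hl : l.length = w.length)
          (hb : UnivSteenrod.dickson p (j + 1) l (UnivSteenrod.consL p (b + p ^ w.length) F) ≠ 0) :
          b < a := by
        obtain ⟨t, ht, hF⟩ := dickson_ne_zero hb
        have := h.head_le hF
        linarith
      have h1 := ih (by simpa using hj) h.consL
      refine ⟨?_, fun b l hl hb => ?_⟩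
      · refine (congrArg (_ + ·) h1.1).trans (add_eq_right.2 ?_)
        by_contra hne
        exact lt_irrefl _ (hsmall a w rfl hne)
      · rw [dickson_succ_cons, hl] at hb
        by_cases h0 : UnivSteenrod.dickson p (j + 1) l
            (UnivSteenrod.consL p (b + p ^ w.length) F) = 0
        · rw [h0, zero_add] at hb
          obtain ⟨t, ht, hF⟩ := dickson_ne_zero hb
          have hle := h.head_le hF
          rcases (show b ≤ a by linarith).lt_or_eq with hlt | rfl
          · exact Or.inl hlt
          · exact Or.inr ⟨rfl, (h1.2 l hb).2⟩
        · exact Or.inl (hsmall b l hl h0)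

/-- The indicator function of a word with all gaps equal to `1` is annihilated by the relations. -/
theorem single_mem_Sym (hp : 2 ≤ p) {w : List ℤ} (hw : w.IsChain fun a b => a = (p : ℤ) * b + 1) :
    (Pi.single w 1 : List ℤ → ZMod p) ∈ Sym p := by
  intro pre post
  refine single_mem_Sym₂ hp fun x y hxy => ?_
  have h : pre ++ x :: y :: post = w := by
    by_contra hne
    exact hxy (Pi.single_eq_of_ne hne _)
  rw [← h, List.isChain_append_cons_cons] at hw
  exact hw.2.1

variable (p) in
/-- The total by which the gaps `a - p b` of a word exceed `1`. -/
def excess : List ℤ → ℤ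
  | [] => 0
  | [_] => 0
  | a :: b :: l => (a - p * b - 1) + excess (b :: l)

theorem excess_nonneg {w : List ℤ} (hw : w.IsChain fun a b => (p : ℤ) * b + 1 ≤ a) :
    0 ≤ excess p w := by
  induction w with
  | nil => exact le_rfl
  | cons a w ih =>
    rcases w with _ | ⟨b, l⟩
    · exact le_rfl
    · rw [List.isChain_cons_cons] at hw
      have := ih hw.2
      rw [excess]
      linarith [hw.1]

/-- Translation by `w₁ ⋯ w_m` changes no gap. -/
theorem raise_zero_isChain {w : List ℤ} (hw : w.IsChain fun a b => (p : ℤ) * b + 1 ≤ a) :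
    (raise p 0 w).IsChain (fun a b => (p : ℤ) * b + 1 ≤ a) ∧
      excess p (raise p 0 w) = excess p w := by
  induction w with
  | nil => simp [raise]
  | cons a w ih =>
    rcases w with _ | ⟨b, l⟩
    · simp [raise, excess]
    · rw [List.isChain_cons_cons] at hw
      obtain ⟨h1, h2⟩ := ih hw.2
      simp only [raise, List.isChain_cons_cons, excess, List.length_cons, pow_succ'] at h1 h2 ⊢
      refine ⟨⟨by linarith [hw.1], h1⟩, ?_⟩
      rw [h2]
      ring

/-- An admissible word has all gaps equal to `1`, or some gap can be lowered by `raise`. -/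
theorem exists_raise {w : List ℤ} (hw : w.IsChain fun a b => (p : ℤ) * b + 1 ≤ a) :
    w.IsChain (fun a b => a = (p : ℤ) * b + 1) ∨ ∃ j, j + 1 ≤ w.length ∧
      (raise p (j + 1) w).IsChain (fun a b => (p : ℤ) * b + 1 ≤ a) ∧
      excess p (raise p (j + 1) w) < excess p w := by
  induction w with
  | nil => simp
  | cons a w ih =>
    rcases w with _ | ⟨b, l⟩
    · simp
    · rw [List.isChain_cons_cons] at hw
      by_cases hab : a = p * b + 1
      · rcases ih hw.2 with h | ⟨j, hj, h1, h2⟩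
        · exact Or.inl (List.isChain_cons_cons.2 ⟨hab, h⟩)
        · refine Or.inr ⟨j + 1, by simpa using hj, ?_⟩
          simp only [raise, List.isChain_cons_cons, excess, List.length_cons, pow_succ'] at h1 h2 ⊢
          exact ⟨⟨by linarith, h1⟩, by linarith⟩
      · obtain ⟨h1, h2⟩ := raise_zero_isChain hw.2
        refine Or.inr ⟨0, by simp, ?_⟩
        have hlt := lt_of_le_of_ne hw.1 (Ne.symm hab)
        simp only [raise, List.isChain_cons_cons, excess, List.length_cons, pow_succ',
          pow_zero] at h1 h2 ⊢
        exact ⟨⟨by linarith, h1⟩, by linarith⟩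

/-- Every admissible word is the leading word of a function annihilated by the relations. -/
theorem exists_leads [Fact p.Prime] {w : List ℤ}
    (hw : w.IsChain fun a b => (p : ℤ) * b + 1 ≤ a) : ∃ F ∈ Sym p, Leads F w := by
  induction hN : (excess p w).toNat using Nat.strong_induction_on generalizing w with
  | _ N ih =>
    rcases exists_raise hw with h | ⟨j, hj, h1, h2⟩
    · refine ⟨Pi.single w 1, single_mem_Sym (Fact.out : p.Prime).two_le h, Pi.single_eq_same _ _,
        fun l hl => ?_⟩
      have : l = w := by
        by_contra hne
        exact hl (Pi.single_eq_of_ne hne _)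
      exact ⟨by rw [this], this.le⟩
    · have := excess_nonneg h1
      obtain ⟨F, hF, hlead⟩ := ih _ (by omega) h1 rfl
      exact ⟨_, dickson_mem _ hF, hlead.dickson hj⟩

end Words

/-! ### The action of the universal Steenrod algebra and linear independence -/

section Action

variable (p : ℕ)

/-- The operator by which `z_{ε,k}` acts: `F ↦ F (k :: ·)` for `ε = 1`, and `0` for `ε = 0`. -/
def genAct (x : Idx) : Module.End (ZMod p) (Sym p) :=
  if x.1 = 1 then
    { toFun := fun F => ⟨consL p x.2 F, consL_mem F.2 x.2⟩
      map_add' := fun _ _ => rfl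
      map_smul' := fun _ _ => rfl }
  else 0

/-- The action of the free algebra on `Sym p`, from the right. -/
def freeAct : FreeZ p →ₐ[ZMod p] (Module.End (ZMod p) (Sym p))ᵐᵒᵖ :=
  FreeAlgebra.lift (ZMod p) fun x => MulOpposite.op (genAct p x)

variable {p}

theorem genAct_zero (k : ℤ) : genAct p (0, k) = 0 := by
  simp [genAct]

theorem genAct_one_apply (k : ℤ) (F : Sym p) (l : List ℤ) :
    (genAct p (1, k) F : List ℤ → ZMod p) l = (F : List ℤ → ZMod p) (k :: l) := by
  rw [genAct, if_pos rfl]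
  rfl

@[simp] theorem freeAct_gen (ε : Fin 2) (k : ℤ) :
    freeAct p (gen p ε k) = MulOpposite.op (genAct p (ε, k)) := by
  simp [freeAct, gen]

/-- The relation `S(1,k,n)` without its vanishing last sum, indexed by `i = n - j`. -/
theorem relS_one_eq [Fact p.Prime] (k : ℤ) (n : ℕ) :
    relS p 1 k n = ∑ i ∈ Finset.range (n + 1),
      ademCoeff p n i • (gen p 1 (p * k - n + i) * gen p 1 (k - i)) := by
  have hp := (Fact.out : p.Prime).two_le
  rw [relS, ← Finset.sum_range_reflect
    (fun j => ((-1 : ZMod p) ^ j * (binom (((p : ℤ) - 1) * ((n : ℤ) - j) - 1) j : ZMod p)) •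
          (gen p 1 (p * k - j) * gen p 1 (k - n + j)))]
  rw [Finset.sum_range_succ', Finset.sum_range_succ' (fun i => ademCoeff p n i • _)]
  have h0 : binom (((p : ℤ) - 1) * ((n : ℤ) - (n + 1 - 1 - 0 : ℕ)) - 1) (n + 1 - 1 - 0) = 0 := by
    rw [binom, if_neg]
    simp
  rw [h0, ademCoeff_zero]
  simp only [Fin.isValue, Fin.val_one, Nat.cast_one, sub_self, zero_smul, add_zero, Nat.cast_zero,
    mul_zero, sub_zero, one_smul]
  rw [add_comm]
  congr 1
  refine Finset.sum_congr rfl fun i hi => ?_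
  rw [Finset.mem_range] at hi
  obtain ⟨j, rfl⟩ : ∃ j, n = i + 1 + j := ⟨n - (i + 1), by omega⟩
  have e1 : i + 1 + j + 1 - 1 - (i + 1) = j := by omega
  have e2 : ((p : ℤ) - 1) * (((i + 1 + j : ℕ) : ℤ) - j) - 1 = (((p - 1) * (i + 1) - 1 : ℕ) : ℤ) := by
    have : 1 ≤ (p - 1) * (i + 1) := Nat.mul_pos (by omega) (by omega)
    push_cast [this, (by omega : 1 ≤ p)]
    ring
  have e3 : (p : ℤ) * k - (i + 1 + j : ℕ) + (i + 1 : ℕ) = p * k - j := by push_cast; ring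
  have e4 : k - ((i + 1 + j : ℕ) : ℤ) + j = k - (i + 1 : ℕ) := by push_cast; ring
  rw [e1, e2, e3, e4, ademCoeff_succ hp, if_pos (by omega), binom, if_pos (by positivity),
    Int.toNat_natCast, Nat.add_sub_cancel_left]

theorem freeAct_rel [Fact p.Prime] {x y : FreeZ p} (h : Rel p x y) :
    freeAct p x = freeAct p y := by
  rw [← MulOpposite.unop_inj]
  rcases h with ⟨ε, k, n⟩ | ⟨ε, k, n⟩
  · simp [relR, genAct_zero]
  · fin_cases ε
    · simp [relS, genAct_zero]
    · simp only [Fin.mk_one, relS_one_eq, map_sum, map_smul, map_mul, freeAct_gen, map_zero,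
        Finset.unop_sum, MulOpposite.unop_smul, MulOpposite.unop_mul, MulOpposite.unop_op,
        MulOpposite.unop_zero]
      ext F l
      have := F.2 [] l k n
      simpa [LinearMap.sum_apply, genAct_one_apply] using this

variable (p) in
/-- The right action of the universal Steenrod algebra on `Sym p`. -/
def act [Fact p.Prime] : Q p →ₐ[ZMod p] (Module.End (ZMod p) (Sym p))ᵐᵒᵖ :=
  RingQuot.liftAlgHom (ZMod p) ⟨freeAct p, fun _ _ h => freeAct_rel h⟩

theorem act_z [Fact p.Prime] (x : Idx) : act p (z p x) = MulOpposite.op (genAct p x) := by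
  rw [act, z, RingQuot.liftAlgHom_mkAlgHom_apply, freeAct_gen]

/-- The monomial `z_{1,k₁} ⋯ z_{1,k_m}` acts by deleting the initial segment `k₁, …, k_m`. -/
theorem act_zMon [Fact p.Prime] (h : List ℤ) (F : Sym p) (l : List ℤ) :
    ((act p (zMon p (h.map fun k => (1, k)))).unop F : List ℤ → ZMod p) l =
      (F : List ℤ → ZMod p) (h ++ l) := by
  induction h generalizing F with
  | nil => simp [zMon]
  | cons a h ih =>
    have : zMon p ((a :: h).map fun k => ((1, k) : Idx)) =
        z p (1, a) * zMon p (h.map fun k => (1, k)) := by simp [zMon]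
    rw [this, map_mul, MulOpposite.unop_mul, Module.End.mul_apply, ih, act_z,
      MulOpposite.unop_op, genAct_one_apply]
    rfl

/-- The functional on `Q(p)` that a function in `Sym p` defines. -/
def pairing [Fact p.Prime] (F : Sym p) : Q p →ₗ[ZMod p] ZMod p :=
  LinearMap.proj (R := ZMod p) (φ := fun _ : List ℤ => ZMod p) [] ∘ₗ (Sym p).subtype ∘ₗ
    LinearMap.applyₗ F ∘ₗ (MulOpposite.opLinearEquiv (ZMod p)).symm.toLinearMap ∘ₗ
      (act p).toLinearMap

theorem pairing_zMon [Fact p.Prime] (h : List ℤ) (F : Sym p) :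
    pairing F (zMon p (h.map fun k => (1, k))) = (F : List ℤ → ZMod p) h := by
  have := act_zMon h F []
  rwa [List.append_nil] at this

/-- The admissible monomials in the `z_{1,k}` are linearly independent, by triangularity with respect
to functions that have them as leading words. -/
theorem linearIndependent_zMon [Fact p.Prime] : LinearIndependent (ZMod p)
    fun w : {w : List ℤ // w.IsChain fun a b => (p : ℤ) * b + 1 ≤ a} =>
      zMon p (w.1.map fun k => (1, k)) := by
  rw [linearIndependent_iff']
  intro T g hg
  by_contra! hne
  obtain ⟨w₀, hw₀, hgw₀⟩ := hne
  -- a lexicographically smallest word with nonzero coefficient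
  obtain ⟨w, hw, hmin⟩ := Finset.exists_min_image (T.filter fun w => g w ≠ 0) (fun w => w.1)
    ⟨w₀, Finset.mem_filter.2 ⟨hw₀, hgw₀⟩⟩
  rw [Finset.mem_filter] at hw
  obtain ⟨F, hF, hlead⟩ := exists_leads w.2
  have h := congrArg (pairing ⟨F, hF⟩) hg
  rw [map_sum, map_zero, Finset.sum_eq_single_of_mem w hw.1] at h
  · rw [map_smul, pairing_zMon] at h
    exact hw.2 (by simpa [hlead.1] using h)
  · intro v hv hvw
    rw [map_smul, pairing_zMon, smul_eq_mul]
    by_contra h0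
    have hle := (hlead.2 v.1 (right_ne_zero_of_mul h0)).2
    have hge := hmin v (Finset.mem_filter.2 ⟨hv, left_ne_zero_of_mul h0⟩)
    exact hvw (Subtype.ext (le_antisymm hle hge))

end Action

/-! ### Divisibility of the indices in the relations -/

section Spanning

variable {p : ℕ}

/-- The relations at indices divisible by `p ^ s` only involve such indices, by Lucas' theorem. -/
theorem pow_dvd_of_choose_ne_zero [Fact p.Prime] (s : ℕ) {i j : ℕ} (hij : p ^ s ∣ i + j)
    (h0 : 0 < i) (h : (((p - 1) * i - 1).choose j : ZMod p) ≠ 0) : p ^ s ∣ j := by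
  induction s generalizing i j with
  | zero => simp
  | succ s ih =>
    have hp := (Fact.out : p.Prime).two_le
    have hpij : p ∣ i + j := (dvd_pow_self p s.succ_ne_zero).trans hij
    obtain ⟨q, rfl⟩ : ∃ q, p = q + 1 := ⟨p - 1, by omega⟩
    rw [Nat.add_sub_cancel] at h
    have hlucas := (ZMod.natCast_eq_natCast_iff _ _ _).2
      (Choose.choose_modEq_choose_mod_mul_choose_div_nat (n := q * i - 1) (k := j) (p := q + 1))
    rw [hlucas, Nat.cast_mul] at h
    have hqi : 1 ≤ q * i := Nat.mul_pos (by omega) h0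
    have hpj : (q + 1) ∣ j := by
      by_contra hj
      refine left_ne_zero_of_mul h ?_
      rw [Nat.choose_eq_zero_of_lt, Nat.cast_zero]
      -- the upper entry is congruent to `j - 1`
      obtain ⟨m, hm⟩ := hpij
      have hr : 0 < j % (q + 1) := Nat.pos_of_ne_zero fun h => hj (Nat.dvd_of_mod_eq_zero h)
      have hjd := Nat.div_add_mod j (q + 1)
      have hlt : j % (q + 1) < q + 1 := Nat.mod_lt j (Nat.succ_pos q)
      have hmod : ((q * i - 1 : ℕ) : ℤ) % (q + 1 : ℕ) = ((j % (q + 1) - 1 : ℕ) : ℤ) := by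
        have : ((q * i - 1 : ℕ) : ℤ) = ((j % (q + 1) - 1 : ℕ) : ℤ) +
            ((q + 1 : ℕ) : ℤ) * (i + (j / (q + 1) : ℕ) - m) := by
          zify at hm hjd
          rw [Nat.cast_sub hqi, Nat.cast_sub hr]
          push_cast
          linear_combination -hjd - hm
        rw [this, Int.add_mul_emod_self_left, Int.emod_eq_of_lt (by positivity) (by omega)]
      have : (q * i - 1) % (q + 1) = j % (q + 1) - 1 := by exact_mod_cast hmod
      omega
    obtain ⟨j, rfl⟩ := hpj
    obtain ⟨i, rfl⟩ := (Nat.dvd_add_left (dvd_mul_right _ _)).1 hpij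
    have hdiv : (q * ((q + 1) * i) - 1) / (q + 1) = q * i - 1 := by
      have hqi : 1 ≤ q * i := Nat.mul_pos (by omega) (Nat.pos_of_mul_pos_left h0)
      have : q * ((q + 1) * i) - 1 = (q + 1) * (q * i - 1) + q := by
        zify [hqi, (by nlinarith : 1 ≤ q * ((q + 1) * i))]
        ring
      rw [this, Nat.mul_add_div (by omega), Nat.div_eq_of_lt (by omega), add_zero]
    rw [hdiv, Nat.mul_div_cancel_left _ (by omega)] at h
    rw [pow_succ'] at hij ⊢
    rw [← mul_add] at hij
    exact Nat.mul_dvd_mul_left _ (ih (Nat.dvd_of_mul_dvd_mul_left (by omega) hij)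
      (Nat.pos_of_mul_pos_left h0) (right_ne_zero_of_mul h))

end Spanning

/-! ### Termination of the rewriting -/

section Termination

variable (p : ℕ)

/-- The weighted entries `c p ^ i h_i` of the word are at most `M`. -/
def WeightedLE (M : ℤ) : ℤ → List ℤ → Prop
  | _, [] => True
  | c, a :: l => c * a ≤ M ∧ WeightedLE M (c * p) l

/-- The sum of `(m - i) (K - h_i)` over the entries of a word `h_0, …, h_{m-1}`. -/
def deficit (K : ℤ) : List ℤ → ℤ
  | [] => 0
  | a :: l => (l.length + 1) * (K - a) + deficit K l

variable {p}

theorem WeightedLE.mono {M M' c : ℤ} {l : List ℤ} (h : WeightedLE p M c l) (hM : M ≤ M') :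
    WeightedLE p M' c l := by
  induction l generalizing c with
  | nil => trivial
  | cons a l ih => exact ⟨h.1.trans hM, ih h.2⟩

theorem exists_weightedLE (c : ℤ) (l : List ℤ) : ∃ M, 0 ≤ M ∧ WeightedLE p M c l := by
  induction l generalizing c with
  | nil => exact ⟨0, le_rfl, trivial⟩
  | cons a l ih =>
    obtain ⟨M, hM, h⟩ := ih (c * p)
    exact ⟨max M (c * a), hM.trans (le_max_left _ _), le_max_right _ _, h.mono (le_max_left _ _)⟩

/-- A rewriting step keeps the weighted entries bounded. -/
theorem WeightedLE.rewrite {M c : ℤ} (hc : 0 ≤ c) {pre post : List ℤ} {x y x' y' : ℤ}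
    (h : WeightedLE p M c (pre ++ x :: y :: post)) (hx : x' ≤ p * y) (hy : y' ≤ y) :
    WeightedLE p M c (pre ++ x' :: y' :: post) := by
  induction pre generalizing c with
  | nil =>
    obtain ⟨-, h2, h3⟩ := h
    refine ⟨?_, ?_, h3⟩
    · exact (mul_le_mul_of_nonneg_left hx hc).trans (by rwa [← mul_assoc])
    · exact (mul_le_mul_of_nonneg_left hy (by positivity)).trans h2
  | cons a pre ih => exact ⟨h.1, ih (by positivity) h.2⟩

theorem WeightedLE.deficit_nonneg (hp : 1 ≤ p) {M c : ℤ} (hM : 0 ≤ M) (hc : 1 ≤ c) {l : List ℤ}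
    (h : WeightedLE p M c l) : 0 ≤ deficit M l := by
  induction l generalizing c with
  | nil => exact le_rfl
  | cons a l ih =>
    have ha : a ≤ M := by
      by_contra! hlt
      nlinarith [h.1]
    have hcp : 1 ≤ c * (p : ℤ) := by
      have : (1 : ℤ) ≤ p := by exact_mod_cast hp
      nlinarith
    have h1 := ih hcp h.2
    have h2 : 0 ≤ ((l.length : ℤ) + 1) * (M - a) :=
      mul_nonneg (by positivity) (by linarith)
    rw [deficit]
    linarith

theorem deficit_lt (K : ℤ) {pre post : List ℤ} {x y x' y' : ℤ} (hsum : x' + y' = x + y)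
    (hx : x < x') : deficit K (pre ++ x' :: y' :: post) < deficit K (pre ++ x :: y :: post) := by
  induction pre with
  | nil =>
    obtain rfl : y' = x + y - x' := by linarith
    simp only [List.nil_append, deficit, List.length_cons]
    push_cast
    linarith
  | cons a pre ih =>
    simp only [List.cons_append, deficit, List.length_append, List.length_cons] at ih ⊢
    linarith

end Termination

/-! ### Spanning, and the basis -/

section Span

variable {p : ℕ}

theorem label1_append (s : ℕ) (l t : List ℤ) : label1 p s (l ++ t) = label1 p s l ++ label1 p s t :=
  List.map_append

theorem zMon_append (I J : List Idx) : zMon p (I ++ J) = zMon p I * zMon p J := by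
  simp [zMon]

theorem admissible_label1_iff (hp : 0 < p) (s : ℕ) (h : List ℤ) :
    Admissible p (label1 p s h) ↔ h.IsChain fun a b => (p : ℤ) * b + 1 ≤ a := by
  have hs : (0 : ℤ) < (p : ℤ) ^ s := by positivity
  rw [Admissible, label1, List.isChain_map]
  refine iff_of_eq (congrArg (fun r => List.IsChain r h) ?_)
  ext a b
  simp only [Fin.isValue, Fin.val_one, Nat.cast_one, Int.add_one_le_iff, mul_left_comm (p : ℤ)]
  exact mul_lt_mul_iff_right₀ hs

/-- The relation `S(1,k,n)`, solved for its nonadmissible product. -/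
theorem z_mul_z [Fact p.Prime] (k : ℤ) (n : ℕ) :
    z p (1, p * k - n) * z p (1, k) = -∑ i ∈ Finset.range n, ademCoeff p n (i + 1) •
      (z p (1, p * k - n + (i + 1 : ℕ)) * z p (1, k - (i + 1 : ℕ))) := by
  have h := RingQuot.mkAlgHom_rel (ZMod p) (Rel.S (p := p) 1 k n)
  rw [relS_one_eq, Finset.sum_range_succ', ademCoeff_zero, map_add, map_sum, map_zero] at h
  simp only [map_smul, map_mul, one_smul, Nat.cast_zero, add_zero, sub_zero] at h
  exact eq_neg_of_add_eq_zero_right h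

/-- A nonadmissible product of two of the generators `z_{1,p^s m}` is a combination of products
with the same sum of indices in which the first index is larger, but bounded by the second. -/
theorem zMon_pair_mem_span [Fact p.Prime] (s : ℕ) {x y : ℤ} (hxy : x ≤ p * y) :
    zMon p (label1 p s [x, y]) ∈ Submodule.span (ZMod p)
      {a | ∃ x' y' : ℤ, x' + y' = x + y ∧ x < x' ∧ x' ≤ p * y ∧ y' ≤ y ∧
        a = zMon p (label1 p s [x', y'])} := by
  have hp := (Fact.out : p.Prime).two_le
  have hzz (u v : ℤ) : zMon p (label1 p s [u, v]) = z p (1, p ^ s * u) * z p (1, p ^ s * v) := by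
    simp [zMon, label1]
  obtain ⟨n, rfl⟩ : ∃ n : ℕ, x = p * y - n := ⟨(p * y - x).toNat, by omega⟩
  have e : (p : ℤ) ^ s * (p * y - n) = p * (p ^ s * y) - (p ^ s * n : ℕ) := by push_cast; ring
  rw [hzz, e, z_mul_z]
  refine Submodule.neg_mem _ (Submodule.sum_mem _ fun i hi => ?_)
  by_cases h0 : ademCoeff p (p ^ s * n) (i + 1) = 0
  · rw [h0, zero_smul]
    exact Submodule.zero_mem _
  refine Submodule.smul_mem _ _ (Submodule.subset_span ?_)
  rw [Finset.mem_range] at hi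
  rw [ademCoeff_succ hp, if_pos (by omega)] at h0
  have hj := pow_dvd_of_choose_ne_zero s (i := i + 1) (j := p ^ s * n - (i + 1))
    (by rw [Nat.add_sub_cancel' (by omega)]; exact dvd_mul_right _ _) (by omega)
    (right_ne_zero_of_mul h0)
  have hdvd : p ^ s ∣ i + 1 :=
    (Nat.dvd_sub_iff_right (by omega) (dvd_mul_right _ _)).1 hj
  obtain ⟨m, hm⟩ := hdvd
  have hs : 0 < p ^ s := by positivity
  have hm0 : 0 < m := Nat.pos_of_ne_zero fun h => by simp [h] at hm
  have hmn : m ≤ n := Nat.le_of_mul_le_mul_left (by omega : p ^ s * m ≤ p ^ s * n) hs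
  refine ⟨p * y - n + m, y - m, by ring, by omega, by omega, by omega, ?_⟩
  rw [hzz, hm]
  push_cast
  congr 3 <;> ring_nf

/-- Admissible monomials span: rewriting nonadmissible pairs keeps the weighted entries bounded and
lowers the deficit, so that it terminates. -/
theorem zMon_mem_span [Fact p.Prime] (s : ℕ) (h : List ℤ) :
    zMon p (label1 p s h) ∈ Submodule.span (ZMod p) (zMon p '' admLabels1 p s) := by
  have hp := (Fact.out : p.Prime).pos
  obtain ⟨M, hM, hle⟩ := exists_weightedLE (p := p) 1 h
  induction hN : (deficit M h).toNat using Nat.strong_induction_on generalizing h with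
  | _ N ih =>
    by_cases hadm : h.IsChain fun a b => (p : ℤ) * b + 1 ≤ a
    · exact Submodule.subset_span
        ⟨_, ⟨⟨h, rfl⟩, (admissible_label1_iff hp s h).2 hadm⟩, rfl⟩
    rw [List.isChain_iff_forall_rel_of_append_cons_cons] at hadm
    push Not at hadm
    obtain ⟨x, y, pre, post, rfl, hxy⟩ := hadm
    have hsplit (u v : ℤ) : zMon p (label1 p s (pre ++ u :: v :: post)) =
        zMon p (label1 p s pre) * zMon p (label1 p s [u, v]) * zMon p (label1 p s post) := by
      rw [← zMon_append, ← zMon_append, ← label1_append, ← label1_append]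
      simp
    rw [hsplit]
    have hmem := zMon_pair_mem_span s (p := p) (x := x) (y := y) (by omega)
    generalize zMon p (label1 p s [x, y]) = a at hmem ⊢
    induction hmem using Submodule.span_induction with
    | mem a ha =>
      obtain ⟨x', y', hsum, hx, hx', hy', rfl⟩ := ha
      rw [← hsplit]
      have hle' := hle.rewrite zero_le_one hx' hy'
      have h1 := deficit_lt M (pre := pre) (post := post) hsum hx
      have h2 := hle'.deficit_nonneg hp hM le_rfl
      exact ih _ (by omega) _ hle' rfl
    | zero => simp
    | add a b _ _ ha hb =>
      rw [mul_add, add_mul]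
      exact Submodule.add_mem _ ha hb
    | smul c a _ ha =>
      rw [mul_smul_comm, smul_mul_assoc]
      exact Submodule.smul_mem _ _ ha

theorem zMon_mem_Q1 (s : ℕ) (h : List ℤ) : zMon p (label1 p s h) ∈ Q1 p s := by
  refine Subalgebra.list_prod_mem _ fun a ha => ?_
  simp only [label1, List.map_map, List.mem_map] at ha
  obtain ⟨m, -, rfl⟩ := ha
  exact Algebra.subset_adjoin ⟨m, rfl⟩

theorem span_zMon_eq [Fact p.Prime] (s : ℕ) :
    Submodule.span (ZMod p) (zMon p '' admLabels1 p s) = Subalgebra.toSubmodule (Q1 p s) := by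
  refine le_antisymm (Submodule.span_le.2 ?_) ?_
  · rintro _ ⟨_, ⟨⟨h, rfl⟩, -⟩, rfl⟩
    exact zMon_mem_Q1 s h
  · rw [Q1, Algebra.adjoin_eq_span, Submodule.span_le]
    intro a ha
    obtain ⟨l, hl, rfl⟩ := Submonoid.exists_list_of_mem_closure ha
    obtain ⟨h, rfl⟩ : ∃ h : List ℤ, h.map (fun m => z p (1, (p : ℤ) ^ s * m)) = l := by
      rwa [← Set.mem_range, Set.range_list_map]
    have := zMon_mem_span s (p := p) h
    rwa [zMon, label1, List.map_map] at this

/-- The case of general `s`, a subfamily of the admissible monomials in all `z_{1,k}`. -/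
theorem linearIndependent_admLabels1 [Fact p.Prime] (s : ℕ) :
    LinearIndependent (ZMod p) fun I : admLabels1 p s => zMon p (I : List Idx) := by
  have hp := (Fact.out : p.Prime).pos
  have hfst (I : admLabels1 p s) : (I.1.map Prod.snd).map (fun k => ((1, k) : Idx)) = I.1 := by
    obtain ⟨_, ⟨h, rfl⟩, -⟩ := I
    simp [label1]
  let f : admLabels1 p s → {w : List ℤ // w.IsChain fun a b => (p : ℤ) * b + 1 ≤ a} :=
    fun I => ⟨I.1.map Prod.snd, by
      rw [← admissible_label1_iff hp 0]
      simpa [label1, hfst] using I.2.2⟩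
  have hf : Function.Injective f := fun I J hIJ => by
    have := congrArg (fun w => w.1.map fun k => ((1, k) : Idx)) hIJ
    exact Subtype.ext (by simpa only [f, hfst] using this)
  have := linearIndependent_zMon.comp f hf
  simpa only [Function.comp_def, f, hfst] using this

end Span

end UnivSteenrod

end

theorem proposition3p3 (p : ℕ) [Fact p.Prime] (hp : p ≠ 2) (s : ℕ) :
    (∃ b : Module.Basis (UnivSteenrod.admLabels1 p s) (ZMod p) (UnivSteenrod.Q1 p s),
        ∀ I : UnivSteenrod.admLabels1 p s,
          ((b I : UnivSteenrod.Q1 p s) : UnivSteenrod.Q p) = UnivSteenrod.zMon p (I : List UnivSteenrod.Idx)) ∧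
      (∀ h : List ℤ, UnivSteenrod.Admissible p (UnivSteenrod.label1 p s h) ↔
        h.IsChain fun a b => (p : ℤ) * b + 1 ≤ a) := by
  refine ⟨?_, UnivSteenrod.admissible_label1_iff (Fact.out : p.Prime).pos s⟩
  have hspan : Submodule.span (ZMod p) (Set.range fun I : UnivSteenrod.admLabels1 p s =>
      UnivSteenrod.zMon p (I : List UnivSteenrod.Idx)) =
        Subalgebra.toSubmodule (UnivSteenrod.Q1 p s) := by
    rw [← UnivSteenrod.span_zMon_eq, Set.image_eq_range]
  let b := (Module.Basis.span (UnivSteenrod.linearIndependent_admLabels1 (p := p) s)).map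
    (LinearEquiv.ofEq _ _ hspan)
  refine ⟨b, fun I => ?_⟩
  change ((LinearEquiv.ofEq _ _ hspan (Module.Basis.span
    (UnivSteenrod.linearIndependent_admLabels1 (p := p) s) I)) : UnivSteenrod.Q p) = _
  rw [LinearEquiv.coe_ofEq_apply, Module.Basis.span_apply]
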